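/- For a real number $\lambda>1$, the logarithmic lattice with spacing factor $\lambda$ is $\Lambda=\{\pm\lambda^n : n\in\mathbb Z\}$. Three points $k,p,q\in\Lambda$ form a triad if $k=p+q$; then $k$ is said to interact with $p$ and with $q$. The lattice is nondegenerate if every two of its nodes are joined by a finite sequence of such interactions. The triads at unity are the ordered pairs $(p,q)\in\Lambda\times\Lambda$ with $1=p+q$. Let $$\sigma=\frac{\sqrt[3]{9+\sqrt{69}}+\sqrt[3]{9-\sqrt{69}}}{\sqrt[3]{18}}\approx 1.325$$ be the plastic number. **Theorem.** A logarithmic lattice with spacing factor $\lambda\ge 1.05$ is nondegenerate if and only if one of the following holds: (i) $\lambda=2$. In this case there are exactly three triads at unity: $(2,-1)$, $(-1,2)$, $(\tfrac12,\tfrac12)$. (ii) $\lambda=\sigma$. In this case there are exactly twelve triads at unity: $(\sigma^3,-\sigma)$, $(\sigma^2,-\sigma^{-1})$, $(\sigma^{-3},\sigma^{-2})$, $(\sigma^5,-\sigma^4)$, $(\sigma,-\sigma^{-4})$, $(\sigma^{-5},\sigma^{-1})$, and the same six pairs with their entries exchanged. (iii) $1=\lambda^b-\lambda^a$ for some coprime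 integers $1\le a<b\le 62$ with $(a,b)\ne(1,3)$ and $(a,b)\neq(4,5)$. In this case, for any such $(a,b)$, there are exactly six triads at unity: $(\lambda^b,-\lambda^a)$, $(\lambda^{b-a},-\lambda^{-a})$, $(\lambda^{-b},\lambda^{a-b})$, and the same three pairs with their entries exchanged. Moreover, let $0\le a_1<b_1$, $0\le a_2<b_2$ be integers with $a_1<a_2$, and let $\lambda\ge1.05$. Then $\lambda$ is a common root of $x^{b_1}-x^{a_1}-1$ and $x^{b_2}-x^{a_2}-1$ if and only if, for some $m\in\{1,2,3,4,5\}$, $\lambda=\sigma^{1/m}$, $(a_1,b_1)=(m,3m)$ and $(a_2,b_2)=(4m,5m)$. -/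

import Mathlib

namespace LogLattice

/-- The logarithmic lattice `{± lam ^ n : n ∈ ℤ}` with spacing factor `lam`. -/
def lattice (lam : ℝ) : Set ℝ :=
  {k | ∃ n : ℤ, k = lam ^ n ∨ k = -lam ^ n}

/-- Three lattice points `k, p, q` form a triad if `k = p + q`. -/
def IsTriad (lam k p q : ℝ) : Prop :=
  k ∈ lattice lam ∧ p ∈ lattice lam ∧ q ∈ lattice lam ∧ k = p + q

/-- `k` interacts with `p` if `k, p` are part of a triad `k = p + q`.
(By commutativity of addition, `k` then also interacts with `q`; the relation is symmetric
because the lattice is symmetric under `q ↦ -q`.) -/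
def Interacts (lam k p : ℝ) : Prop :=
  ∃ q : ℝ, IsTriad lam k p q

/-- The lattice is nondegenerate if every two nodes interact through a finite sequence
of triads. -/
def Nondegenerate (lam : ℝ) : Prop :=
  ∀ k ∈ lattice lam, ∀ p ∈ lattice lam, Relation.ReflTransGen (Interacts lam) k p

/-- The triads at unity: all `(p, q)` with `p, q` in the lattice and `1 = p + q`. -/
def triadsAtUnity (lam : ℝ) : Set (ℝ × ℝ) :=
  {pq | IsTriad lam 1 pq.1 pq.2}

/-- The plastic number. -/
noncomputable def plastic : ℝ :=
  ((9 + √69) ^ (1 / 3 : ℝ) + (9 - √69) ^ (1 / 3 : ℝ)) / (18 : ℝ) ^ (1 / 3 : ℝ)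

/-- The table of triads at unity for spacing factor `2`. -/
def tableTwo : Set (ℝ × ℝ) :=
  {(2, -1), (-1, 2), (1 / 2, 1 / 2)}

/-- The table of triads at unity for a spacing factor with `1 = lam ^ b - lam ^ a`. -/
def tableGeneral (lam : ℝ) (a b : ℤ) : Set (ℝ × ℝ) :=
  {(lam ^ b, -lam ^ a), (-lam ^ a, lam ^ b),
   (lam ^ (b - a), -lam ^ (-a)), (-lam ^ (-a), lam ^ (b - a)),
   (lam ^ (-b), lam ^ (a - b)), (lam ^ (a - b), lam ^ (-b))}

/-- The table of triads at unity for the plastic number `s`. -/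
def tableExtended (s : ℝ) : Set (ℝ × ℝ) :=
  {(s ^ 3, -s), (-s, s ^ 3),
   (s ^ 2, -s ^ (-1 : ℤ)), (-s ^ (-1 : ℤ), s ^ 2),
   (s ^ (-3 : ℤ), s ^ (-2 : ℤ)), (s ^ (-2 : ℤ), s ^ (-3 : ℤ)),
   (s ^ 5, -s ^ 4), (-s ^ 4, s ^ 5),
   (s, -s ^ (-4 : ℤ)), (-s ^ (-4 : ℤ), s),
   (s ^ (-5 : ℤ), s ^ (-1 : ℤ)), (s ^ (-1 : ℤ), s ^ (-5 : ℤ))}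

/-- `lam` is a root of the trinomial `1 = lam ^ b - lam ^ a`. -/
def IsTrinomialRoot (lam : ℝ) (a b : ℕ) : Prop :=
  1 = lam ^ b - lam ^ a

/-- The exponent pairs of the generic case: coprime `1 ≤ a < b ≤ 62` other than
`(1, 3)` and `(4, 5)`. The remaining coprime pair with `0 = a < b` is `(0, 1)`, i.e. `lam = 2`. -/
def GenericPair (a b : ℕ) : Prop :=
  1 ≤ a ∧ a < b ∧ b ≤ 62 ∧ Nat.Coprime a b ∧ (a, b) ≠ (1, 3) ∧ (a, b) ≠ (4, 5)

end LogLattice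

/-!
Dividing `k = p + q` by `k` turns every triad into a triad at unity, and a triad at unity is, up to
the symmetries of the equation, a relation `1 = lam ^ b - lam ^ a`. Everything therefore rests on
how many such relations a given `lam > 1` satisfies.

Let `f₁ = P * C₁` and `f₂ = P * C₂` be trinomials `X ^ b - X ^ a - 1` with root `lam`, where `P` is
the minimal polynomial of `lam`. By Ljunggren's argument one of the factors `P`, `Cᵢ` of the unit
trinomial `fᵢ` is self-reciprocal; it is not `P`, since `lam⁻¹` is not a root of `fᵢ`. Hence both
`Cᵢ` are self-reciprocal, which makes `f₁` times the mirror of `f₂` equal to `f₂` times the mirror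
of `f₁`. Comparing exponents leaves only `X ^ (3 * m) - X ^ m - 1` and
`X ^ (5 * m) - X ^ (4 * m) - 1`, whose common factor has the root `lam` with `lam ^ m` the plastic
number.

Since interactions are scale invariant, the component of `1` is a subgroup of the nodes. It contains
`-1`, `lam ^ a` and `lam ^ b`, hence every node if `a` and `b` are coprime. Conversely, if `d`
divides the exponents of all relations, interactions never leave the lattice of `lam ^ d`.
-/

namespace LogLattice

open Polynomial

variable {lam : ℝ}

/-! ### Factors of unit trinomials -/

theorem coeff_sum_map_X_pow {R : Type*} [Semiring R] (s : Multiset ℕ) (n : ℕ) :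
    (s.map fun i => (X : R[X]) ^ i).sum.coeff n = s.count n := by
  induction s using Multiset.induction with
  | empty => simp
  | cons i s ih =>
    simp only [Multiset.map_cons, Multiset.sum_cons, coeff_add, coeff_X_pow, ih,
      Multiset.count_cons, Nat.cast_add, Nat.cast_ite, Nat.cast_one, Nat.cast_zero, add_comm]

theorem sum_map_X_pow_injective {R : Type*} [Semiring R] [CharZero R] :
    Function.Injective fun s : Multiset ℕ => (s.map fun i => (X : R[X]) ^ i).sum := by
  intro s t h
  ext n
  have hn := congrArg (coeff · n) h
  simpa only [coeff_sum_map_X_pow, Nat.cast_inj] using hn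

theorem associated_or_associated_mirror_of_mul_mirror_eq {p q : ℤ[X]} (hp : p.IsUnitTrinomial)
    (h : p * p.mirror = q * q.mirror) : Associated q p ∨ Associated q p.mirror := by
  obtain ⟨k', m', n', hkm', hmn', x, y, z, hq⟩ := (isUnitTrinomial_iff'' h).1 hp
  obtain ⟨k, m, n, hkm, hmn, u, v, w, hp⟩ := hp
  obtain rfl : k = k' := by
    have := congrArg natTrailingDegree h
    rwa [natTrailingDegree_mul_mirror, natTrailingDegree_mul_mirror, hp, hq,
      trinomial_natTrailingDegree hkm hmn u.ne_zero,
      trinomial_natTrailingDegree hkm' hmn' x.ne_zero, mul_right_inj' two_ne_zero] at this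
  obtain rfl : n = n' := by
    have := congrArg natDegree h
    rwa [natDegree_mul_mirror, natDegree_mul_mirror, hp, hq, trinomial_natDegree hkm hmn w.ne_zero,
      trinomial_natDegree hkm' hmn' z.ne_zero, mul_right_inj' two_ne_zero] at this
  by_cases hvy : y = v
  · subst hvy
    refine (IsUnitTrinomial.irreducible_aux3 hkm hmn hkm' hmn' u y w x z hp hq h).imp ?_ ?_ <;>
      rintro rfl <;> rfl
  · have hneg : -q = trinomial k m' n ((-x : ℤˣ) : ℤ) v ((-z : ℤˣ) : ℤ) := by
      rw [hq, Int.units_ne_iff_eq_neg.1 hvy]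
      simp only [trinomial_def, Units.val_neg, C_neg]
      ring
    rw [← Associated.neg_left_iff, ← Associated.neg_left_iff (b := p.mirror)]
    refine (IsUnitTrinomial.irreducible_aux3 hkm hmn hkm' hmn' u v w (-x) (-z) hp hneg
      (by rw [mirror_neg, neg_mul_neg, h])).imp ?_ ?_ <;>
      intro e <;> rw [e]

theorem associated_mirror_or_associated_mirror_of_mul {p q : ℤ[X]}
    (h : (p * q).IsUnitTrinomial) : Associated p.mirror p ∨ Associated q.mirror q := by
  have hp : p ≠ 0 := left_ne_zero_of_mul h.ne_zero
  have hq : q.mirror ≠ 0 := mirror_eq_zero.not.2 (right_ne_zero_of_mul h.ne_zero)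
  have key : p * q * (p * q).mirror = p * q.mirror * (p * q.mirror).mirror := by
    simp only [mirror_mul_of_domain, mirror_mirror]
    ring
  rcases associated_or_associated_mirror_of_mul_mirror_eq h key with h | h
  · exact .inr (h.of_mul_left (.refl p) hp)
  · rw [mirror_mul_of_domain] at h
    exact .inl (h.of_mul_right (.refl q.mirror) hq).symm

theorem aeval_inv_mirror_eq_zero_iff {K : Type*} [Field K] {x : K} (hx : x ≠ 0) {p : ℤ[X]} :
    aeval x⁻¹ p.mirror = 0 ↔ aeval x p = 0 := by
  have := invertibleOfNonzero hx
  rw [mirror, map_mul, map_pow, aeval_X, mul_eq_zero,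
    or_iff_left (pow_ne_zero _ (inv_ne_zero hx)), aeval_def, ← invOf_eq_inv,
    eval₂_reverse_eq_zero_iff, aeval_def]

/-! ### Common roots of two trinomials -/

theorem IsTrinomialRoot.lt (hlam : 1 < lam) {a b : ℕ} (h : IsTrinomialRoot lam a b) : a < b := by
  refine (pow_lt_pow_iff_right₀ hlam).1 ?_
  unfold IsTrinomialRoot at h
  linarith

theorem IsTrinomialRoot.right_unique (hlam : 1 < lam) {a b b' : ℕ}
    (h : IsTrinomialRoot lam a b) (h' : IsTrinomialRoot lam a b') : b = b' := by
  unfold IsTrinomialRoot at h h'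
  exact pow_right_injective₀ (by linarith) hlam.ne' (by linarith : lam ^ b = lam ^ b')

theorem isTrinomialRoot_mul {m a b : ℕ} :
    IsTrinomialRoot lam (a * m) (b * m) ↔ IsTrinomialRoot (lam ^ m) a b := by
  rw [IsTrinomialRoot, IsTrinomialRoot, ← pow_mul', ← pow_mul']

theorem not_isTrinomialRoot_inv (hlam : 1 < lam) (a b : ℕ) : ¬ IsTrinomialRoot lam⁻¹ a b := by
  have h0 : 0 < lam⁻¹ ^ a := by positivity
  have h1 : lam⁻¹ ^ b ≤ 1 := pow_le_one₀ (by positivity) (inv_le_one_of_one_le₀ hlam.le)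
  unfold IsTrinomialRoot
  linarith

/-- The polynomial `X ^ b - X ^ a - 1`, whose roots satisfy `IsTrinomialRoot`, written as a
`Polynomial.trinomial` to make the API of unit trinomials applicable. -/
noncomputable def rootTrinomial (a b : ℕ) : ℤ[X] :=
  trinomial 0 a b (-1) (-1) 1

theorem rootTrinomial_eq (a b : ℕ) : rootTrinomial a b = X ^ b - X ^ a - 1 := by
  simp only [rootTrinomial, trinomial_def, C_neg, C_1, pow_zero]
  ring

theorem aeval_rootTrinomial_eq_zero_iff {a b : ℕ} :
    aeval lam (rootTrinomial a b) = 0 ↔ IsTrinomialRoot lam a b := by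
  simp only [rootTrinomial_eq, map_sub, map_pow, aeval_X, map_one]
  rw [IsTrinomialRoot, sub_eq_zero, eq_comm]

theorem isUnitTrinomial_rootTrinomial {a b : ℕ} (ha : 0 < a) (hab : a < b) :
    (rootTrinomial a b).IsUnitTrinomial :=
  ⟨0, a, b, ha, hab, -1, -1, 1, rfl⟩

theorem rootTrinomial_mirror {a b : ℕ} (ha : 0 < a) (hab : a < b) :
    (rootTrinomial a b).mirror = 1 - X ^ (b - a) - X ^ b := by
  rw [rootTrinomial, trinomial_mirror ha hab (by norm_num) one_ne_zero]
  simp only [trinomial_def, C_neg, C_1, pow_zero]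
  ring

theorem IsTrinomialRoot.isIntegral {a b : ℕ} (hlam : 1 < lam)
    (h : IsTrinomialRoot lam a b) : IsIntegral ℤ lam := by
  have hab := h.lt hlam
  refine ⟨rootTrinomial a b, ?_, aeval_rootTrinomial_eq_zero_iff.2 h⟩
  rw [rootTrinomial_eq, sub_sub]
  refine monic_X_pow_sub ((degree_add_le _ _).trans_lt (max_lt ?_ ?_))
  · rw [degree_X_pow]
    exact_mod_cast hab
  · rw [degree_one]
    exact_mod_cast pos_of_gt hab

theorem IsTrinomialRoot.associated_mirror_of_eq_mul (hlam : 1 < lam) {a b : ℕ}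
    (ha : 0 < a) (h : IsTrinomialRoot lam a b) {p q : ℤ[X]} (hp : aeval lam p = 0)
    (hpq : rootTrinomial a b = p * q) : Associated q.mirror q := by
  have hunit := isUnitTrinomial_rootTrinomial ha (h.lt hlam)
  rw [hpq] at hunit
  refine (associated_mirror_or_associated_mirror_of_mul hunit).resolve_left fun hassoc => ?_
  have hinv : aeval lam⁻¹ p.mirror = 0 := (aeval_inv_mirror_eq_zero_iff (by positivity)).2 hp
  have hdvd : p.mirror ∣ rootTrinomial a b := hassoc.dvd.trans ⟨q, hpq⟩
  exact not_isTrinomialRoot_inv hlam a b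
    (aeval_rootTrinomial_eq_zero_iff.1 (aeval_eq_zero_of_dvd_aeval_eq_zero hdvd hinv))

theorem IsTrinomialRoot.rootTrinomial_mul_mirror_comm (hlam : 1 < lam)
    {a₁ b₁ a₂ b₂ : ℕ} (ha₁ : 0 < a₁) (ha₂ : 0 < a₂) (h₁ : IsTrinomialRoot lam a₁ b₁)
    (h₂ : IsTrinomialRoot lam a₂ b₂) :
    rootTrinomial a₁ b₁ * (rootTrinomial a₂ b₂).mirror =
      rootTrinomial a₂ b₂ * (rootTrinomial a₁ b₁).mirror := by
  have hint := h₁.isIntegral hlam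
  have hp : aeval lam (minpoly ℤ lam) = 0 := minpoly.aeval ℤ lam
  obtain ⟨q₁, hq₁⟩ := minpoly.isIntegrallyClosed_dvd hint (aeval_rootTrinomial_eq_zero_iff.2 h₁)
  obtain ⟨q₂, hq₂⟩ := minpoly.isIntegrallyClosed_dvd hint (aeval_rootTrinomial_eq_zero_iff.2 h₂)
  have hassoc : Associated (rootTrinomial a₁ b₁ * (rootTrinomial a₂ b₂).mirror)
      (rootTrinomial a₂ b₂ * (rootTrinomial a₁ b₁).mirror) := by
    have hq := ((h₁.associated_mirror_of_eq_mul hlam ha₁ hp hq₁).symm.mul_mul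
      (h₂.associated_mirror_of_eq_mul hlam ha₂ hp hq₂)).mul_left
        (minpoly ℤ lam * (minpoly ℤ lam).mirror)
    rwa [hq₁, hq₂, mirror_mul_of_domain, mirror_mul_of_domain, mul_mul_mul_comm,
      mul_mul_mul_comm _ q₂, mul_comm q₂]
  obtain ⟨u, hu⟩ := hassoc
  obtain ⟨r, -, hr⟩ := isUnit_iff.1 u.isUnit
  have heval : ∀ a b, (rootTrinomial a b).eval 1 = -1 := fun a b => by simp [rootTrinomial_eq]
  have hr1 : r = 1 := by
    simpa [← hr, heval, mirror_eval_one] using congrArg (eval 1) hu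
  rw [← hu, ← hr, hr1, C_1, mul_one]

theorem exponents_eq_of_rootTrinomial_mul_mirror_comm {a₁ b₁ a₂ b₂ : ℕ} (ha₁ : 0 < a₁)
    (h₁ : a₁ < b₁) (h₂ : a₂ < b₂) (h : a₁ < a₂)
    (hcomm : rootTrinomial a₁ b₁ * (rootTrinomial a₂ b₂).mirror =
      rootTrinomial a₂ b₂ * (rootTrinomial a₁ b₁).mirror) :
    b₁ = 3 * a₁ ∧ a₂ = 4 * a₁ ∧ b₂ = 5 * a₁ := by
  obtain ⟨c₁, rfl⟩ := Nat.exists_eq_add_of_le h₁.le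
  obtain ⟨c₂, rfl⟩ := Nat.exists_eq_add_of_le h₂.le
  rw [rootTrinomial_mirror ha₁ h₁, rootTrinomial_mirror (ha₁.trans h) h₂, rootTrinomial_eq,
    rootTrinomial_eq, Nat.add_sub_cancel_left, Nat.add_sub_cancel_left] at hcomm
  -- After cancellation all monomials carry the same sign, so only their exponents matter.
  have key : ({a₁ + c₁ + c₂, a₁, a₂ + c₁, a₁ + a₂ + c₁, c₁} : Multiset ℕ) =
      {a₂ + c₁ + c₂, a₂, a₁ + c₂, a₁ + a₂ + c₂, c₂} := by
    refine sum_map_X_pow_injective (R := ℤ) ?_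
    simp only [Multiset.insert_eq_cons, Multiset.map_cons, Multiset.map_singleton,
      Multiset.sum_cons, Multiset.sum_singleton]
    linear_combination -hcomm
  have hsum : a₁ + 3 * c₁ = a₂ + 3 * c₂ := by
    have := congrArg Multiset.sum key
    simp only [Multiset.insert_eq_cons, Multiset.sum_cons, Multiset.sum_singleton] at this
    lia
  have hc₂ : c₂ = a₁ := by
    have : c₂ ∈ ({a₁ + c₁ + c₂, a₁, a₂ + c₁, a₁ + a₂ + c₁, c₁} : Multiset ℕ) := by
      rw [key]; simp
    simp only [Multiset.insert_eq_cons, Multiset.mem_cons, Multiset.mem_singleton] at this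
    lia
  have hc₁ : c₁ = 2 * a₁ := by
    have : c₁ ∈ ({a₂ + c₁ + c₂, a₂, a₁ + c₂, a₁ + a₂ + c₂, c₂} : Multiset ℕ) := by
      rw [← key]; simp
    simp only [Multiset.insert_eq_cons, Multiset.mem_cons, Multiset.mem_singleton] at this
    lia
  lia

theorem IsTrinomialRoot.isIntegral_inv (hlam : 1 < lam) {a b : ℕ} (ha : 0 < a)
    (h : IsTrinomialRoot lam a b) : IsIntegral ℤ lam⁻¹ := by
  have hint := h.isIntegral hlam
  have hinv : lam⁻¹ = lam ^ (b - 1) - lam ^ (a - 1) := by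
    have hb : 0 < b := ha.trans (h.lt hlam)
    rw [IsTrinomialRoot, ← Nat.sub_add_cancel hb, ← Nat.sub_add_cancel ha, pow_succ, pow_succ,
      ← sub_mul] at h
    exact inv_eq_of_mul_eq_one_left h.symm
  rw [hinv]
  exact (hint.pow _).sub (hint.pow _)

theorem not_isIntegral_inv_two : ¬ IsIntegral ℤ (2⁻¹ : ℝ) := by
  intro h
  have hrat : IsIntegral ℤ (algebraMap ℚ ℝ 2⁻¹) := by simpa using h
  rw [isIntegral_algebraMap_iff (algebraMap ℚ ℝ).injective, IsIntegrallyClosed.isIntegral_iff]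
    at hrat
  obtain ⟨n, hn⟩ := hrat
  have : (n * 2 : ℚ) = 1 := by
    rw [eq_intCast] at hn
    rw [hn, inv_mul_cancel₀ two_ne_zero]
  norm_cast at this
  lia

-- Otherwise `lam` is a unit among the algebraic integers, while its power `lam ^ c = 2` is not.
theorem IsTrinomialRoot.left_eq_zero (hlam : 1 < lam) {a b c : ℕ}
    (h : IsTrinomialRoot lam a b) (h₀ : IsTrinomialRoot lam 0 c) : a = 0 := by
  by_contra! ha
  have hint := (h.isIntegral_inv hlam (Nat.pos_of_ne_zero ha)).pow c
  rw [IsTrinomialRoot, pow_zero] at h₀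
  rw [inv_pow, show lam ^ c = 2 by linarith] at hint
  exact not_isIntegral_inv_two hint

theorem IsTrinomialRoot.eq_of_lt (hlam : 1 < lam) {a₁ b₁ a₂ b₂ : ℕ}
    (h₁ : IsTrinomialRoot lam a₁ b₁) (h₂ : IsTrinomialRoot lam a₂ b₂) (h : a₁ < a₂) :
    b₁ = 3 * a₁ ∧ a₂ = 4 * a₁ ∧ b₂ = 5 * a₁ := by
  have ha₁ : 0 < a₁ := by
    by_contra! ha₁
    obtain rfl : a₁ = 0 := by lia
    exact h.ne' (h₂.left_eq_zero hlam h₁)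
  exact exponents_eq_of_rootTrinomial_mul_mirror_comm ha₁ (h₁.lt hlam) (h₂.lt hlam) h
    (h₁.rootTrinomial_mul_mirror_comm hlam ha₁ (ha₁.trans h) h₂)

theorem IsTrinomialRoot.eq_or_exists (hlam : 1 < lam) {a₁ b₁ a₂ b₂ : ℕ}
    (h₁ : IsTrinomialRoot lam a₁ b₁) (h₂ : IsTrinomialRoot lam a₂ b₂) :
    (a₁ = a₂ ∧ b₁ = b₂) ∨
      (∃ m, a₁ = m ∧ b₁ = 3 * m ∧ a₂ = 4 * m ∧ b₂ = 5 * m) ∨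
      ∃ m, a₂ = m ∧ b₂ = 3 * m ∧ a₁ = 4 * m ∧ b₁ = 5 * m := by
  rcases lt_trichotomy a₁ a₂ with hlt | rfl | hlt
  · exact .inr (.inl ⟨a₁, by grind [h₁.eq_of_lt hlam h₂ hlt]⟩)
  · exact .inl ⟨rfl, h₁.right_unique hlam h₂⟩
  · exact .inr (.inr ⟨a₂, by grind [h₂.eq_of_lt hlam h₁ hlt]⟩)

/-! ### The plastic number -/

theorem sqrt_sixty_nine_lt : √69 < 9 := by
  rw [Real.sqrt_lt' (by norm_num)]
  norm_num

theorem plastic_pos : 0 < plastic := by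
  have : 0 < 9 - √69 := sub_pos.2 sqrt_sixty_nine_lt
  unfold plastic
  positivity

theorem plastic_pow_three : plastic ^ 3 = plastic + 1 := by
  have cube_cbrt {x : ℝ} (hx : 0 ≤ x) : (x ^ (1 / 3 : ℝ)) ^ 3 = x := by
    simpa using Real.rpow_inv_natCast_pow hx three_ne_zero
  have hx : 0 ≤ (9 + √69) / 18 := by positivity
  have hy : 0 ≤ (9 - √69) / 18 := div_nonneg (sub_nonneg.2 sqrt_sixty_nine_lt.le) (by norm_num)
  set u := ((9 + √69) / 18) ^ (1 / 3 : ℝ) with hu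
  set v := ((9 - √69) / 18) ^ (1 / 3 : ℝ) with hv
  have hplastic : plastic = u + v := by
    rw [plastic, hu, hv, Real.div_rpow (by positivity) (by norm_num),
      Real.div_rpow (sub_nonneg.2 sqrt_sixty_nine_lt.le) (by norm_num), add_div]
  have hu3 : u ^ 3 = (9 + √69) / 18 := cube_cbrt hx
  have hv3 : v ^ 3 = (9 - √69) / 18 := cube_cbrt hy
  have huv : u * v = 1 / 3 := by
    refine (pow_left_inj₀ (by positivity) (by norm_num) three_ne_zero).1 ?_
    rw [mul_pow, hu3, hv3]
    linear_combination -(1 / 324) * Real.sq_sqrt (show (0 : ℝ) ≤ 69 by norm_num)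
  calc plastic ^ 3 = u ^ 3 + v ^ 3 + 3 * (u * v) * (u + v) := by rw [hplastic]; ring
    _ = plastic + 1 := by rw [hu3, hv3, huv, hplastic]; ring

theorem one_lt_plastic : 1 < plastic := by
  by_contra! h
  have := pow_le_one₀ plastic_pos.le h (n := 3)
  linarith [plastic_pow_three, plastic_pos]

theorem isTrinomialRoot_one_three_iff : IsTrinomialRoot lam 1 3 ↔ lam = plastic := by
  rw [IsTrinomialRoot]
  constructor
  · intro h
    have hfactor : (lam - plastic) * (lam ^ 2 + lam * plastic + plastic ^ 2 - 1) = 0 := by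
      linear_combination -h - plastic_pow_three
    have hsq : 4 / 3 < plastic ^ 2 := by
      nlinarith [plastic_pow_three, one_lt_plastic]
    have hpos : 0 < lam ^ 2 + lam * plastic + plastic ^ 2 - 1 := by
      linarith [sq_nonneg (lam + plastic / 2)]
    exact sub_eq_zero.1 ((mul_eq_zero_iff_right hpos.ne').1 hfactor)
  · rintro rfl
    linear_combination -plastic_pow_three

theorem isTrinomialRoot_four_five_iff : IsTrinomialRoot lam 4 5 ↔ lam = plastic := by
  have hpos : 0 < lam ^ 2 - lam + 1 := by nlinarith [sq_nonneg (lam - 1 / 2)]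
  have hfactor : lam ^ 5 - lam ^ 4 - 1 = (lam ^ 2 - lam + 1) * (lam ^ 3 - lam ^ 1 - 1) := by ring
  rw [← isTrinomialRoot_one_three_iff, IsTrinomialRoot, IsTrinomialRoot, eq_comm, ← sub_eq_zero,
    hfactor, mul_eq_zero_iff_left hpos.ne', sub_eq_zero, eq_comm]

theorem isTrinomialRoot_zero_one_iff : IsTrinomialRoot lam 0 1 ↔ lam = 2 := by
  rw [IsTrinomialRoot, pow_one, pow_zero, eq_sub_iff_add_eq, eq_comm, one_add_one_eq_two]

theorem eq_plastic_rpow_iff (hlam : 0 ≤ lam) {m : ℕ} (hm : m ≠ 0) :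
    lam = plastic ^ (1 / (m : ℝ)) ↔ lam ^ m = plastic := by
  rw [one_div, Real.eq_rpow_inv hlam plastic_pos.le (Nat.cast_ne_zero.2 hm), Real.rpow_natCast]

theorem isTrinomialRoot_and_isTrinomialRoot_iff (hlam : 1 < lam) {a₁ b₁ a₂ b₂ : ℕ} (h : a₁ < a₂) :
    IsTrinomialRoot lam a₁ b₁ ∧ IsTrinomialRoot lam a₂ b₂ ↔
      ∃ m : ℕ, 1 ≤ m ∧ lam = plastic ^ (1 / (m : ℝ)) ∧
        a₁ = m ∧ b₁ = 3 * m ∧ a₂ = 4 * m ∧ b₂ = 5 * m := by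
  constructor
  · rintro ⟨h₁, h₂⟩
    obtain ⟨rfl, rfl, rfl⟩ := h₁.eq_of_lt hlam h₂ h
    refine ⟨a₁, by lia, (eq_plastic_rpow_iff (by positivity) (by lia)).2 ?_, rfl, rfl, rfl, rfl⟩
    rwa [← isTrinomialRoot_one_three_iff, ← isTrinomialRoot_mul, one_mul]
  · rintro ⟨m, hm, hlam_eq, rfl, rfl, rfl, rfl⟩
    rw [eq_plastic_rpow_iff (by positivity) (by lia)] at hlam_eq
    constructor
    · rwa [← isTrinomialRoot_one_three_iff, ← isTrinomialRoot_mul, one_mul] at hlam_eq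
    · rwa [← isTrinomialRoot_four_five_iff, ← isTrinomialRoot_mul] at hlam_eq

/-! ### The triads at unity -/

theorem zpow_mem_lattice (lam : ℝ) (n : ℤ) : lam ^ n ∈ lattice lam :=
  ⟨n, .inl rfl⟩

theorem neg_zpow_mem_lattice (lam : ℝ) (n : ℤ) : -lam ^ n ∈ lattice lam :=
  ⟨n, .inr rfl⟩

theorem one_mem_lattice (lam : ℝ) : 1 ∈ lattice lam :=
  zpow_zero lam ▸ zpow_mem_lattice lam 0

theorem mem_triadsAtUnity {p q : ℝ} :
    (p, q) ∈ triadsAtUnity lam ↔ p ∈ lattice lam ∧ q ∈ lattice lam ∧ 1 = p + q :=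
  and_iff_right (one_mem_lattice lam)

theorem mem_triadsAtUnity_swap {p q : ℝ} :
    (p, q) ∈ triadsAtUnity lam ↔ (q, p) ∈ triadsAtUnity lam := by
  rw [mem_triadsAtUnity, mem_triadsAtUnity, and_left_comm, add_comm p]

theorem zpow_sub_eq_one_add_zpow_neg_iff {K : Type*} [Field K] {x : K} (hx : x ≠ 0) {i j : ℤ} :
    x ^ (i - j) = 1 + x ^ (-j) ↔ x ^ i = 1 + x ^ j := by
  rw [← mul_left_inj' (zpow_ne_zero j hx), add_mul, ← zpow_add₀ hx, ← zpow_add₀ hx,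
    sub_add_cancel, neg_add_cancel, zpow_zero, one_mul, add_comm]

theorem zpow_neg_add_zpow_sub_eq_one_iff {K : Type*} [Field K] {x : K} (hx : x ≠ 0) {i j : ℤ} :
    x ^ (-i) + x ^ (j - i) = 1 ↔ x ^ i = 1 + x ^ j := by
  rw [← mul_left_inj' (zpow_ne_zero i hx), add_mul, ← zpow_add₀ hx, ← zpow_add₀ hx,
    sub_add_cancel, neg_add_cancel, zpow_zero, one_mul, eq_comm]

theorem isTrinomialRoot_iff_zpow {a b : ℕ} :
    IsTrinomialRoot lam a b ↔ lam ^ (b : ℤ) = 1 + lam ^ (a : ℤ) := by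
  rw [IsTrinomialRoot, zpow_natCast, zpow_natCast, eq_sub_iff_add_eq, eq_comm]

theorem exists_isTrinomialRoot_of_zpow_eq_one_add_zpow (hlam : 1 < lam) {i j : ℤ}
    (h : lam ^ i = 1 + lam ^ j) :
    ∃ a b : ℕ, IsTrinomialRoot lam a b ∧ (i = b ∧ j = a ∨ i = (b : ℤ) - a ∧ j = -a) := by
  have hi : 0 < i := (one_lt_zpow_iff_right₀ hlam).1 <| h ▸ lt_add_of_pos_right 1 (by positivity)
  rcases le_total 0 j with hj | hj
  · lift i to ℕ using hi.le
    lift j to ℕ using hj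
    exact ⟨j, i, isTrinomialRoot_iff_zpow.2 h, .inl ⟨rfl, rfl⟩⟩
  · obtain ⟨a, rfl⟩ : ∃ a : ℕ, j = -a := ⟨j.natAbs, by lia⟩
    obtain ⟨b, rfl⟩ : ∃ b : ℕ, i = b - a := ⟨(i + a).natAbs, by lia⟩
    rw [zpow_sub_eq_one_add_zpow_neg_iff (by positivity)] at h
    exact ⟨a, b, isTrinomialRoot_iff_zpow.2 h, .inr ⟨rfl, rfl⟩⟩

theorem IsTrinomialRoot.tableGeneral_subset (hlam : lam ≠ 0) {a b : ℕ}
    (h : IsTrinomialRoot lam a b) : tableGeneral lam a b ⊆ triadsAtUnity lam := by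
  rw [isTrinomialRoot_iff_zpow] at h
  have h₁ : (lam ^ (b : ℤ), -lam ^ (a : ℤ)) ∈ triadsAtUnity lam :=
    mem_triadsAtUnity.2 ⟨zpow_mem_lattice _ _, neg_zpow_mem_lattice _ _, by linarith⟩
  have h₂ : (lam ^ ((b : ℤ) - a), -lam ^ (-(a : ℤ))) ∈ triadsAtUnity lam :=
    mem_triadsAtUnity.2 ⟨zpow_mem_lattice _ _, neg_zpow_mem_lattice _ _,
      by linarith [(zpow_sub_eq_one_add_zpow_neg_iff hlam).2 h]⟩
  have h₃ : (lam ^ (-(b : ℤ)), lam ^ ((a : ℤ) - b)) ∈ triadsAtUnity lam :=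
    mem_triadsAtUnity.2 ⟨zpow_mem_lattice _ _, zpow_mem_lattice _ _,
      ((zpow_neg_add_zpow_sub_eq_one_iff hlam).2 h).symm⟩
  rw [tableGeneral]
  simp only [Set.insert_subset_iff, Set.singleton_subset_iff]
  exact ⟨h₁, mem_triadsAtUnity_swap.1 h₁, h₂, mem_triadsAtUnity_swap.1 h₂, h₃,
    mem_triadsAtUnity_swap.1 h₃⟩

theorem mem_triadsAtUnity_iff_exists_isTrinomialRoot (hlam : 1 < lam) {pq : ℝ × ℝ} :
    pq ∈ triadsAtUnity lam ↔ ∃ a b : ℕ, IsTrinomialRoot lam a b ∧ pq ∈ tableGeneral lam a b := by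
  refine ⟨?_, fun ⟨a, b, h, hpq⟩ => h.tableGeneral_subset (by positivity) hpq⟩
  obtain ⟨p, q⟩ := pq
  rw [mem_triadsAtUnity]
  rintro ⟨⟨i, rfl | rfl⟩, ⟨j, rfl | rfl⟩, h⟩
  · have hij : lam ^ (-i) = 1 + lam ^ (j - i) := by
      rw [← zpow_neg_add_zpow_sub_eq_one_iff (by positivity), neg_neg, sub_neg_eq_add,
        sub_add_cancel, h]
    obtain ⟨a, b, hroot, ⟨hi, hj⟩ | ⟨hi, hj⟩⟩ :=
      exists_isTrinomialRoot_of_zpow_eq_one_add_zpow hlam hij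
    · obtain ⟨rfl, rfl⟩ : i = -b ∧ j = a - b := by lia
      exact ⟨a, b, hroot, by simp [tableGeneral]⟩
    · obtain ⟨rfl, rfl⟩ : i = a - b ∧ j = -b := by lia
      exact ⟨a, b, hroot, by simp [tableGeneral]⟩
  · obtain ⟨a, b, hroot, ⟨rfl, rfl⟩ | ⟨rfl, rfl⟩⟩ :=
      exists_isTrinomialRoot_of_zpow_eq_one_add_zpow hlam (i := i) (j := j) (by linarith) <;>
      exact ⟨a, b, hroot, by simp [tableGeneral]⟩
  · obtain ⟨a, b, hroot, ⟨rfl, rfl⟩ | ⟨rfl, rfl⟩⟩ :=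
      exists_isTrinomialRoot_of_zpow_eq_one_add_zpow hlam (i := j) (j := i) (by linarith) <;>
      exact ⟨a, b, hroot, by simp [tableGeneral]⟩
  · have : 0 < lam ^ i := by positivity
    have : 0 < lam ^ j := by positivity
    linarith

theorem IsTrinomialRoot.triadsAtUnity_eq (hlam : 1 < lam) {a b : ℕ} (h : IsTrinomialRoot lam a b)
    (hunique : ∀ a' b' : ℕ, IsTrinomialRoot lam a' b' → a' = a ∧ b' = b) :
    triadsAtUnity lam = tableGeneral lam a b := by
  ext pq
  rw [mem_triadsAtUnity_iff_exists_isTrinomialRoot hlam]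
  refine ⟨fun ⟨a', b', h', hpq⟩ => ?_, fun hpq => ⟨a, b, h, hpq⟩⟩
  obtain ⟨rfl, rfl⟩ := hunique a' b' h'
  exact hpq

theorem triadsAtUnity_two : triadsAtUnity 2 = tableTwo := by
  have hroot : IsTrinomialRoot 2 0 1 := isTrinomialRoot_zero_one_iff.2 rfl
  rw [hroot.triadsAtUnity_eq one_lt_two fun a b h => ?_]
  · have htable : tableGeneral 2 (0 : ℕ) (1 : ℕ) =
        {(2, -1), (-1, 2), (2, -1), (-1, 2), (1 / 2, 1 / 2), (1 / 2, 1 / 2)} := by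
      norm_num [tableGeneral]
    ext pq
    simp only [htable, tableTwo, Set.mem_insert_iff, Set.mem_singleton_iff]
    tauto
  · have := h.eq_or_exists one_lt_two hroot
    lia

theorem triadsAtUnity_plastic : triadsAtUnity plastic = tableExtended plastic := by
  have h13 : IsTrinomialRoot plastic 1 3 := isTrinomialRoot_one_three_iff.2 rfl
  have h45 : IsTrinomialRoot plastic 4 5 := isTrinomialRoot_four_five_iff.2 rfl
  have hunion : triadsAtUnity plastic = tableGeneral plastic 1 3 ∪ tableGeneral plastic 4 5 := by
    refine Set.Subset.antisymm (fun pq hpq => ?_)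
      (Set.union_subset (h13.tableGeneral_subset plastic_pos.ne')
        (h45.tableGeneral_subset plastic_pos.ne'))
    obtain ⟨a, b, h, hpq⟩ :=
      (mem_triadsAtUnity_iff_exists_isTrinomialRoot one_lt_plastic).1 hpq
    obtain ⟨rfl, rfl⟩ | ⟨rfl, rfl⟩ : a = 1 ∧ b = 3 ∨ a = 4 ∧ b = 5 := by
      have := h.eq_or_exists one_lt_plastic h13
      lia
    · exact .inl hpq
    · exact .inr hpq
  ext pq
  rw [hunion, tableGeneral, tableGeneral, tableExtended]
  simp only [Set.mem_union, Set.mem_insert_iff, Set.mem_singleton_iff, or_assoc]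
  norm_num

/-- The exponent pairs of the generic case for arbitrary `lam > 1`, the analogue of `GenericPair`.
The order `a < b` is left to `IsTrinomialRoot`; the bound `62` is specific to `1.05 ≤ lam`. -/
def GenericExponents (a b : ℕ) : Prop :=
  1 ≤ a ∧ Nat.Coprime a b ∧ (a, b) ≠ (1, 3) ∧ (a, b) ≠ (4, 5)

theorem GenericExponents.eq_of_isTrinomialRoot (hlam : 1 < lam) {a b a' b' : ℕ}
    (hab : GenericExponents a b) (h : IsTrinomialRoot lam a b) (h' : IsTrinomialRoot lam a' b') :
    a' = a ∧ b' = b := by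
  obtain ⟨-, hcop, h13, h45⟩ := hab
  simp only [ne_eq, Prod.mk.injEq] at h13 h45
  rcases h'.eq_or_exists hlam h with heq | ⟨m, rfl, rfl, rfl, rfl⟩ | ⟨m, rfl, rfl, rfl, rfl⟩
  · exact heq
  · obtain rfl : a' = 1 := Nat.eq_one_of_dvd_coprimes hcop ⟨4, by lia⟩ ⟨5, by lia⟩
    lia
  · obtain rfl : a = 1 := Nat.eq_one_of_dvd_coprimes hcop dvd_rfl ⟨3, by lia⟩
    lia

theorem GenericExponents.triadsAtUnity_eq (hlam : 1 < lam) {a b : ℕ}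
    (hab : GenericExponents a b) (h : IsTrinomialRoot lam a b) :
    triadsAtUnity lam = tableGeneral lam a b :=
  h.triadsAtUnity_eq hlam fun _ _ h' => hab.eq_of_isTrinomialRoot hlam h h'

/-! ### Counting triads -/

/-- The node of the lattice with given sign (`true` for `+`) and exponent; counting triads of
nodes reduces to counting these formal pairs. -/
noncomputable def node (lam : ℝ) (x : Bool × ℤ) : ℝ :=
  if x.1 then lam ^ x.2 else -lam ^ x.2

theorem node_injective (hlam : 1 < lam) : Function.Injective (node lam) := by
  rintro ⟨s, i⟩ ⟨t, j⟩ h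
  have hi : 0 < lam ^ i := by positivity
  have hj : 0 < lam ^ j := by positivity
  have hinj := zpow_right_injective₀ (by positivity) hlam.ne'
  cases s <;> cases t <;> simp only [node, if_true, Bool.false_eq_true, if_false, neg_inj] at h
  · rw [hinj h]
  · linarith
  · linarith
  · rw [hinj h]

theorem ncard_image_node (hlam : 1 < lam) (s : Finset ((Bool × ℤ) × (Bool × ℤ))) :
    (Prod.map (node lam) (node lam) '' (s : Set ((Bool × ℤ) × (Bool × ℤ)))).ncard = s.card := by
  rw [Set.ncard_image_of_injective _ ((node_injective hlam).prodMap (node_injective hlam)),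
    Set.ncard_coe_finset]

theorem ncard_tableTwo : tableTwo.ncard = 3 := by
  rw [tableTwo, Set.ncard_insert_of_notMem, Set.ncard_pair] <;> norm_num

theorem ncard_tableGeneral (hlam : 1 < lam) {a b : ℤ} (ha : 0 < a) :
    (tableGeneral lam a b).ncard = 6 := by
  have himage : tableGeneral lam a b = Prod.map (node lam) (node lam) ''
      (({((true, b), (false, a)), ((false, a), (true, b)),
        ((true, b - a), (false, -a)), ((false, -a), (true, b - a)),
        ((true, -b), (true, a - b)), ((true, a - b), (true, -b))} :
        Finset ((Bool × ℤ) × (Bool × ℤ))) : Set ((Bool × ℤ) × (Bool × ℤ))) := by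
    simp [tableGeneral, node, Set.image_insert_eq]
  rw [himage, ncard_image_node hlam]
  repeat rw [Finset.card_insert_of_notMem
    (by simp only [Finset.mem_insert, Finset.mem_singleton, Prod.mk.injEq]; grind)]
  rw [Finset.card_singleton]

theorem ncard_tableExtended (hlam : 1 < lam) : (tableExtended lam).ncard = 12 := by
  have himage : tableExtended lam = Prod.map (node lam) (node lam) ''
      (({((true, 3), (false, 1)), ((false, 1), (true, 3)),
        ((true, 2), (false, -1)), ((false, -1), (true, 2)),
        ((true, -3), (true, -2)), ((true, -2), (true, -3)),
        ((true, 5), (false, 4)), ((false, 4), (true, 5)),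
        ((true, 1), (false, -4)), ((false, -4), (true, 1)),
        ((true, -5), (true, -1)), ((true, -1), (true, -5))} :
        Finset ((Bool × ℤ) × (Bool × ℤ))) : Set ((Bool × ℤ) × (Bool × ℤ))) := by
    simp only [tableExtended, Finset.coe_insert, Finset.coe_singleton, Set.image_insert_eq,
      Set.image_singleton, Prod.map_apply, node, if_true, Bool.false_eq_true, if_false,
      zpow_ofNat, pow_one]
  rw [himage, ncard_image_node hlam]
  decide

/-! ### Nondegenerate lattices -/

theorem neg_mem_lattice {x : ℝ} (hx : x ∈ lattice lam) : -x ∈ lattice lam := by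
  obtain ⟨n, rfl | rfl⟩ := hx
  · exact neg_zpow_mem_lattice _ _
  · rw [neg_neg]
    exact zpow_mem_lattice _ _

theorem mul_mem_lattice {x y : ℝ} (hlam : lam ≠ 0) (hx : x ∈ lattice lam)
    (hy : y ∈ lattice lam) : x * y ∈ lattice lam := by
  obtain ⟨m, rfl | rfl⟩ := hx <;> obtain ⟨n, rfl | rfl⟩ := hy <;> refine ⟨m + n, ?_⟩ <;>
    simp [zpow_add₀ hlam]

theorem inv_mem_lattice {x : ℝ} (hx : x ∈ lattice lam) : x⁻¹ ∈ lattice lam := by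
  obtain ⟨m, rfl | rfl⟩ := hx <;> refine ⟨-m, ?_⟩ <;> simp

theorem ne_zero_of_mem_lattice {x : ℝ} (hlam : lam ≠ 0) (hx : x ∈ lattice lam) : x ≠ 0 := by
  obtain ⟨m, rfl | rfl⟩ := hx
  · exact zpow_ne_zero m hlam
  · exact neg_ne_zero.2 (zpow_ne_zero m hlam)

instance symm_interacts (lam : ℝ) : Std.Symm (Interacts lam) where
  symm _ _ := fun ⟨q, hk, hp, hq, h⟩ => ⟨-q, hp, hk, neg_mem_lattice hq, by linarith⟩

theorem Interacts.mul_left {k p x : ℝ} (hlam : lam ≠ 0) (hx : x ∈ lattice lam)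
    (h : Interacts lam k p) : Interacts lam (x * k) (x * p) := by
  obtain ⟨q, hk, hp, hq, rfl⟩ := h
  exact ⟨x * q, mul_mem_lattice hlam hx hk, mul_mem_lattice hlam hx hp,
    mul_mem_lattice hlam hx hq, mul_add x p q⟩

theorem reflTransGen_interacts_mul_left {k p x : ℝ} (hlam : lam ≠ 0) (hx : x ∈ lattice lam)
    (h : Relation.ReflTransGen (Interacts lam) k p) :
    Relation.ReflTransGen (Interacts lam) (x * k) (x * p) :=
  h.lift (x * ·) fun _ _ => Interacts.mul_left hlam hx

/-- The component of unity: the nodes joined to `1` by finitely many interactions. Since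
interactions are scale invariant, these form a subgroup of the units of `ℝ`. -/
def unityComponent (lam : ℝ) (hlam : lam ≠ 0) : Subgroup ℝˣ where
  carrier := {u | (u : ℝ) ∈ lattice lam ∧ Relation.ReflTransGen (Interacts lam) 1 u}
  one_mem' := ⟨one_mem_lattice lam, .refl⟩
  mul_mem' {u v} := fun ⟨hu, hu'⟩ ⟨hv, hv'⟩ => by
    refine ⟨mul_mem_lattice hlam hu hv, hu'.trans ?_⟩
    simpa using reflTransGen_interacts_mul_left hlam hu hv'
  inv_mem' {u} := fun ⟨hu, hu'⟩ => by
    have hinv : (↑u⁻¹ : ℝ) ∈ lattice lam := by simpa using inv_mem_lattice hu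
    refine ⟨hinv, symm_of _ ?_⟩
    simpa using reflTransGen_interacts_mul_left hlam hinv hu'

theorem mem_unityComponent_of_mem_triadsAtUnity (hlam : lam ≠ 0) {u : ℝˣ} {q : ℝ}
    (h : ((u : ℝ), q) ∈ triadsAtUnity lam) : u ∈ unityComponent lam hlam :=
  ⟨(mem_triadsAtUnity.1 h).1, .single ⟨q, h⟩⟩

theorem nondegenerate_of_mem_unityComponent (hlam : lam ≠ 0)
    (hneg : -1 ∈ unityComponent lam hlam) (h : Units.mk0 lam hlam ∈ unityComponent lam hlam) :
    Nondegenerate lam := by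
  have hall : ∀ x ∈ lattice lam, Relation.ReflTransGen (Interacts lam) 1 x := by
    rintro x ⟨n, rfl | rfl⟩
    · simpa using (zpow_mem h n).2
    · simpa using (mul_mem hneg (zpow_mem h n)).2
  exact fun k hk p hp => (symm_of _ (hall k hk)).trans (hall p hp)

theorem IsTrinomialRoot.nondegenerate (hlam : lam ≠ 0) {a b : ℕ}
    (hab : Nat.Coprime a b) (h : IsTrinomialRoot lam a b) : Nondegenerate lam := by
  set u : ℝˣ := Units.mk0 lam hlam with hu
  have hsub := h.tableGeneral_subset hlam
  have hb : u ^ (b : ℤ) ∈ unityComponent lam hlam :=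
    mem_unityComponent_of_mem_triadsAtUnity hlam (q := -lam ^ (a : ℤ))
      (hsub (by simp [tableGeneral, hu]))
  have hdiff : u ^ ((a : ℤ) - b) ∈ unityComponent lam hlam :=
    mem_unityComponent_of_mem_triadsAtUnity hlam (q := lam ^ (-(b : ℤ)))
      (hsub (by simp [tableGeneral, hu]))
  have hnega : -u ^ (a : ℤ) ∈ unityComponent lam hlam :=
    mem_unityComponent_of_mem_triadsAtUnity hlam (q := lam ^ (b : ℤ))
      (hsub (by simp [tableGeneral, hu]))
  have ha : u ^ (a : ℤ) ∈ unityComponent lam hlam := by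
    have := mul_mem hdiff hb
    rwa [← zpow_add, sub_add_cancel] at this
  have hneg : -1 ∈ unityComponent lam hlam := by
    simpa using mul_mem hnega (inv_mem ha)
  have hbezout : (a : ℤ) * Nat.gcdA a b + b * Nat.gcdB a b = 1 := by
    rw [← Nat.gcd_eq_gcd_ab, hab.gcd_eq_one, Nat.cast_one]
  refine nondegenerate_of_mem_unityComponent hlam hneg ?_
  have := mul_mem (zpow_mem ha (Nat.gcdA a b)) (zpow_mem hb (Nat.gcdB a b))
  rwa [← zpow_mul, ← zpow_mul, ← zpow_add, hbezout, zpow_one] at this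

theorem tableGeneral_mul (lam : ℝ) (d a b : ℤ) :
    tableGeneral lam (d * a) (d * b) = tableGeneral (lam ^ d) a b := by
  simp only [tableGeneral, ← mul_sub, ← mul_neg, zpow_mul]

theorem triadsAtUnity_subset_pow (hlam : 1 < lam) {d : ℕ}
    (hd : ∀ a b : ℕ, IsTrinomialRoot lam a b → d ∣ a ∧ d ∣ b) :
    triadsAtUnity lam ⊆ triadsAtUnity (lam ^ d) := by
  intro pq hpq
  obtain ⟨a, b, h, hpq⟩ := (mem_triadsAtUnity_iff_exists_isTrinomialRoot hlam).1 hpq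
  obtain ⟨⟨a, rfl⟩, ⟨b, rfl⟩⟩ := hd a b h
  rw [mul_comm d a, mul_comm d b, isTrinomialRoot_mul] at h
  rw [Nat.cast_mul, Nat.cast_mul, tableGeneral_mul, zpow_natCast] at hpq
  exact h.tableGeneral_subset (by positivity) hpq

theorem Interacts.mem_lattice_of_triadsAtUnity_subset {mu : ℝ} (hlam : lam ≠ 0) (hmu : mu ≠ 0)
    (hsub : triadsAtUnity lam ⊆ triadsAtUnity mu) {k p : ℝ} (h : Interacts lam k p)
    (hk : k ∈ lattice mu) : p ∈ lattice mu := by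
  obtain ⟨q, hk', hp, hq, hkpq⟩ := h
  have hk0 : k ≠ 0 := ne_zero_of_mem_lattice hmu hk
  have hscaled : (k⁻¹ * p, k⁻¹ * q) ∈ triadsAtUnity lam :=
    mem_triadsAtUnity.2 ⟨mul_mem_lattice hlam (inv_mem_lattice hk') hp,
      mul_mem_lattice hlam (inv_mem_lattice hk') hq,
      by rw [← mul_add, ← hkpq, inv_mul_cancel₀ hk0]⟩
  rw [← mul_inv_cancel_left₀ hk0 p]
  exact mul_mem_lattice hmu hk (mem_triadsAtUnity.1 (hsub hscaled)).1

theorem Nondegenerate.lattice_subset_of_triadsAtUnity_subset {mu : ℝ} (hlam : lam ≠ 0)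
    (hmu : mu ≠ 0) (h : Nondegenerate lam) (hsub : triadsAtUnity lam ⊆ triadsAtUnity mu) :
    lattice lam ⊆ lattice mu := by
  intro x hx
  induction h 1 (one_mem_lattice lam) x hx with
  | refl => exact one_mem_lattice mu
  | tail _ hstep ih =>
    exact hstep.mem_lattice_of_triadsAtUnity_subset hlam hmu hsub (ih hstep.choose_spec.1)

theorem Nondegenerate.eq_one_of_forall_dvd (hlam : 1 < lam) (h : Nondegenerate lam)
    {d : ℕ} (hd : ∀ a b : ℕ, IsTrinomialRoot lam a b → d ∣ a ∧ d ∣ b) : d = 1 := by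
  have hlam_mem : lam ∈ lattice (lam ^ d) :=
    h.lattice_subset_of_triadsAtUnity_subset (by positivity) (by positivity)
      (triadsAtUnity_subset_pow hlam hd) (by simpa using zpow_mem_lattice lam 1)
  obtain ⟨n, hn | hn⟩ := hlam_mem
  · rw [← zpow_natCast, ← zpow_mul] at hn
    have : (d : ℤ) * n = 1 :=
      zpow_right_injective₀ (by positivity) hlam.ne' (hn.symm.trans (zpow_one lam).symm)
    exact Nat.dvd_one.1 (by exact_mod_cast Dvd.intro n this)
  · have : 0 < (lam ^ d) ^ n := by positivity
    linarith

theorem Nondegenerate.exists_isTrinomialRoot (hlam : 1 < lam) (h : Nondegenerate lam) :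
    ∃ a b : ℕ, IsTrinomialRoot lam a b := by
  by_contra! hnone
  exact zero_ne_one (h.eq_one_of_forall_dvd hlam (d := 0) fun a b hab => absurd hab (hnone a b))

theorem Nondegenerate.exists_coprime (hlam : 1 < lam) (h : Nondegenerate lam) :
    ∃ a b : ℕ, Nat.Coprime a b ∧ IsTrinomialRoot lam a b := by
  obtain ⟨a, b, hab⟩ := h.exists_isTrinomialRoot hlam
  refine ⟨a, b, h.eq_one_of_forall_dvd hlam fun a' b' hab' => ?_, hab⟩
  rcases hab'.eq_or_exists hlam hab with
    ⟨rfl, rfl⟩ | ⟨m, rfl, rfl, rfl, rfl⟩ | ⟨m, rfl, rfl, rfl, rfl⟩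
  · exact ⟨Nat.gcd_dvd_left _ _, Nat.gcd_dvd_right _ _⟩
  · simp [Nat.gcd_mul_right]
  · simp

theorem nondegenerate_iff (hlam : 1 < lam) :
    Nondegenerate lam ↔ lam = 2 ∨ lam = plastic ∨
      ∃ a b : ℕ, GenericExponents a b ∧ IsTrinomialRoot lam a b := by
  constructor
  · intro h
    obtain ⟨a, b, hcop, hab⟩ := h.exists_coprime hlam
    rcases a.eq_zero_or_pos with rfl | ha
    · obtain rfl : b = 1 := b.coprime_zero_left.1 hcop
      exact .inl (isTrinomialRoot_zero_one_iff.1 hab)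
    by_cases h13 : (a, b) = (1, 3)
    · obtain ⟨rfl, rfl⟩ := Prod.mk.inj h13
      exact .inr (.inl (isTrinomialRoot_one_three_iff.1 hab))
    by_cases h45 : (a, b) = (4, 5)
    · obtain ⟨rfl, rfl⟩ := Prod.mk.inj h45
      exact .inr (.inl (isTrinomialRoot_four_five_iff.1 hab))
    exact .inr (.inr ⟨a, b, ⟨ha, hcop, h13, h45⟩, hab⟩)
  · have hlam0 : lam ≠ 0 := by positivity
    rintro (hlam2 | hplastic | ⟨a, b, hgen, hab⟩)
    · exact (isTrinomialRoot_zero_one_iff.2 hlam2).nondegenerate hlam0 (by norm_num)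
    · exact (isTrinomialRoot_one_three_iff.2 hplastic).nondegenerate hlam0 (by norm_num)
    · exact hab.nondegenerate hlam0 hgen.2.1

/-! ### Spacing factors bounded away from one -/

theorem IsTrinomialRoot.right_le_sixty_two (hlam : 1.05 ≤ lam) {a b : ℕ}
    (h : IsTrinomialRoot lam a b) : b ≤ 62 := by
  by_contra! hb
  have hlam1 : 1 < lam := lt_of_lt_of_le (by norm_num) hlam
  obtain ⟨c, rfl⟩ : ∃ c, b = c + 1 := ⟨b - 1, by lia⟩
  have hgap : lam ^ c * (lam - 1) ≤ 1 := by
    have : lam ^ a ≤ lam ^ c := pow_le_pow_right₀ hlam1.le (Nat.lt_succ_iff.1 (h.lt hlam1))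
    rw [IsTrinomialRoot, pow_succ] at h
    linarith
  have hbig : 20 < lam ^ c :=
    calc (20 : ℝ) < 1.05 ^ 62 := by norm_num
      _ ≤ lam ^ 62 := by gcongr
      _ ≤ lam ^ c := pow_le_pow_right₀ hlam1.le (by lia)
  nlinarith

theorem le_five_of_eq_plastic_rpow (hlam : 1.05 ≤ lam) {m : ℕ}
    (h : lam = plastic ^ (1 / (m : ℝ))) : m ≤ 5 := by
  by_contra! hm
  have hlam1 : 1 ≤ lam := le_trans (by norm_num) hlam
  have hbig : 1.34 < plastic :=
    calc (1.34 : ℝ) < 1.05 ^ 6 := by norm_num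
      _ ≤ lam ^ 6 := by gcongr
      _ ≤ lam ^ m := pow_le_pow_right₀ hlam1 (by lia)
      _ = plastic := (eq_plastic_rpow_iff (by linarith) (by lia)).1 h
  nlinarith [plastic_pow_three, mul_self_nonneg plastic]

theorem genericPair_and_isTrinomialRoot_iff (hlam : 1.05 ≤ lam) {a b : ℕ} :
    GenericPair a b ∧ IsTrinomialRoot lam a b ↔ GenericExponents a b ∧ IsTrinomialRoot lam a b := by
  refine and_congr_left fun h => ⟨fun ⟨ha, _, _, hab⟩ => ⟨ha, hab⟩, fun ⟨ha, hab⟩ => ?_⟩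
  exact ⟨ha, h.lt (lt_of_lt_of_le (by norm_num) hlam), h.right_le_sixty_two hlam, hab⟩

end LogLattice

theorem theorem1_general :
    (∀ lam : ℝ, 1 < lam →
      (LogLattice.Nondegenerate lam ↔
        lam = 2 ∨ lam = LogLattice.plastic ∨
          ∃ a b : ℕ, LogLattice.GenericExponents a b ∧ LogLattice.IsTrinomialRoot lam a b)) ∧
    (LogLattice.triadsAtUnity 2 = LogLattice.tableTwo ∧
      (LogLattice.triadsAtUnity 2).ncard = 3) ∧
    (LogLattice.triadsAtUnity LogLattice.plastic =
        LogLattice.tableExtended LogLattice.plastic ∧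
      (LogLattice.triadsAtUnity LogLattice.plastic).ncard = 12) ∧
    (∀ lam : ℝ, 1 < lam → ∀ a b : ℕ,
      LogLattice.GenericExponents a b → LogLattice.IsTrinomialRoot lam a b →
        LogLattice.triadsAtUnity lam = LogLattice.tableGeneral lam a b ∧
        (LogLattice.triadsAtUnity lam).ncard = 6) ∧
    (∀ lam : ℝ, 1 < lam → ∀ a₁ b₁ a₂ b₂ : ℕ, a₁ < a₂ →
      ((LogLattice.IsTrinomialRoot lam a₁ b₁ ∧ LogLattice.IsTrinomialRoot lam a₂ b₂) ↔
        ∃ m : ℕ, 1 ≤ m ∧ lam = LogLattice.plastic ^ (1 / (m : ℝ)) ∧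
          a₁ = m ∧ b₁ = 3 * m ∧ a₂ = 4 * m ∧ b₂ = 5 * m)) := by
  refine ⟨fun _ => LogLattice.nondegenerate_iff, ⟨LogLattice.triadsAtUnity_two, ?_⟩,
    ⟨LogLattice.triadsAtUnity_plastic, ?_⟩, fun lam hlam a b hab h => ?_,
    fun _ hlam _ _ _ _ => LogLattice.isTrinomialRoot_and_isTrinomialRoot_iff hlam⟩
  · rw [LogLattice.triadsAtUnity_two, LogLattice.ncard_tableTwo]
  · rw [LogLattice.triadsAtUnity_plastic,
      LogLattice.ncard_tableExtended LogLattice.one_lt_plastic]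
  · have htable := hab.triadsAtUnity_eq hlam h
    exact ⟨htable, htable ▸ LogLattice.ncard_tableGeneral hlam (by exact_mod_cast hab.1)⟩

/-- Classification of the nondegenerate logarithmic lattices with spacing factor `≥ 1.05`,
all their triads at unity, and the common roots `≥ 1.05` of two trinomials. -/
theorem theorem1 :
    -- the nondegenerate lattices
    (∀ lam : ℝ, 1.05 ≤ lam →
      (LogLattice.Nondegenerate lam ↔
        lam = 2 ∨ lam = LogLattice.plastic ∨
          ∃ a b : ℕ, LogLattice.GenericPair a b ∧ LogLattice.IsTrinomialRoot lam a b)) ∧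
    -- their triads at unity
    (LogLattice.triadsAtUnity 2 = LogLattice.tableTwo ∧
      (LogLattice.triadsAtUnity 2).ncard = 3) ∧
    (LogLattice.triadsAtUnity LogLattice.plastic =
        LogLattice.tableExtended LogLattice.plastic ∧
      (LogLattice.triadsAtUnity LogLattice.plastic).ncard = 12) ∧
    (∀ lam : ℝ, 1.05 ≤ lam → ∀ a b : ℕ,
      LogLattice.GenericPair a b → LogLattice.IsTrinomialRoot lam a b →
        LogLattice.triadsAtUnity lam = LogLattice.tableGeneral lam a b ∧
        (LogLattice.triadsAtUnity lam).ncard = 6) ∧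
    -- common roots of two distinct trinomials
    (∀ lam : ℝ, 1.05 ≤ lam → ∀ a₁ b₁ a₂ b₂ : ℕ, a₁ < b₁ → a₂ < b₂ → a₁ < a₂ →
      ((LogLattice.IsTrinomialRoot lam a₁ b₁ ∧ LogLattice.IsTrinomialRoot lam a₂ b₂) ↔
        ∃ m : ℕ, 1 ≤ m ∧ m ≤ 5 ∧ lam = LogLattice.plastic ^ (1 / (m : ℝ)) ∧
          a₁ = m ∧ b₁ = 3 * m ∧ a₂ = 4 * m ∧ b₂ = 5 * m)) := by
  obtain ⟨hnondeg, htwo, hplastic, hgeneric, hcommon⟩ := theorem1_general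
  have one_lt {lam : ℝ} (hlam : 1.05 ≤ lam) : 1 < lam := lt_of_lt_of_le (by norm_num) hlam
  refine ⟨fun lam hlam => ?_, htwo, hplastic, fun lam hlam a b hab h => ?_,
    fun lam hlam a₁ b₁ a₂ b₂ _ _ h => ?_⟩
  · simp only [LogLattice.genericPair_and_isTrinomialRoot_iff hlam, hnondeg lam (one_lt hlam)]
  · exact hgeneric lam (one_lt hlam) a b
      ((LogLattice.genericPair_and_isTrinomialRoot_iff hlam).1 ⟨hab, h⟩).1 h
  · rw [hcommon lam (one_lt hlam) a₁ b₁ a₂ b₂ h]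
    exact exists_congr fun m => and_congr_right fun _ =>
      (and_iff_right_of_imp fun hm => LogLattice.le_five_of_eq_plastic_rpow hlam hm.1).symm
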